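/- Let $M^n$ be a smooth Riemannian manifold with curvature tensor $R$ and let $g\colon M^n\to\mathbb{R}^{n+p}$ be an isometric immersion with normal bundle $T_g^\perp M$ and second fundamental form $\alpha\colon TM\times TM\to T_g^\perp M$. For $x\in M$ let $$\Gamma(x)=\{X\in T_xM:\ R(X,Y)=0\ \ \forall\, Y\in T_xM\},\qquad \Delta_g(x)=\{X\in T_xM:\ \alpha(X,Y)=0\ \ \forall\, Y\in T_xM\}$$ be the nullity of $M$ and the relative nullity of $g$ at $x$, let $\mu(x)=\dim\Gamma(x)$ and $\nu_g(x)=\dim\Delta_g(x)$, let $\beta=\alpha|_{T_xM\times\Gamma(x)}$, and let $$\mathcal{S}(\beta)=\operatorname{span}\{\alpha(X,Z):\ X\in T_xM,\ Z\in\Gamma(x)\}\subseteq T_g^\perp M(x).$$ Then, at every point $x\in M$ with $\nu_g(x)\leq n-p-1$, $$\mu(x)-\nu_g(x)\ \leq\ \dim\mathcal{S}(\beta)\ \leq\ p-1 .$$ -/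

import Mathlib

open scoped Manifold ContDiff

set_option maxSynthPendingDepth 3

noncomputable section

/-! ### Bilinear maps -/

namespace BilinearMap

variable {V U W : Type*} [AddCommGroup V] [Module ℝ V] [AddCommGroup U] [Module ℝ U]
  [AddCommGroup W] [Module ℝ W]

/-- `S(β)`: the span of all the values `β(X, Y)` of a bilinear map `β : V × U → W`. -/
def valueSpan (β : V →ₗ[ℝ] U →ₗ[ℝ] W) : Submodule ℝ W :=
  Submodule.span ℝ {w : W | ∃ (X : V) (Y : U), β X Y = w}

/-- The (left) nullity `{X ∈ V | β(X, Y) = 0 for all Y ∈ U}` of a bilinear map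
`β : V × U → W`. -/
def leftNullity (β : V →ₗ[ℝ] U →ₗ[ℝ] W) : Submodule ℝ V where
  carrier := {X : V | ∀ Y : U, β X Y = 0}
  add_mem' := fun {X X'} hX hX' Y => by
    rw [map_add, LinearMap.add_apply, hX Y, hX' Y, add_zero]
  zero_mem' := fun Y => by simp
  smul_mem' := fun c X hX Y => by
    rw [map_smul, LinearMap.smul_apply, hX Y, smul_zero]

end BilinearMap

/-! ### Levi-Civita connection and curvature of a metric on a normed space

Here `G y` is the metric at the point `y` of the coordinate space `E`, and `D_u` is the derivative
in the direction `u`. -/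

namespace MetricInCoordinates

variable {E : Type*} [NormedAddCommGroup E] [NormedSpace ℝ E]

/-- The trilinear map `(u, v, w) ↦ T(w, u, v)` obtained from `T`. -/
def rotate (T : E →L[ℝ] E →L[ℝ] E →L[ℝ] ℝ) : E →L[ℝ] E →L[ℝ] E →L[ℝ] ℝ :=
  (ContinuousLinearMap.flipₗᵢ ℝ E E ℝ).toContinuousLinearEquiv.toContinuousLinearMap.comp T.flip

/-- Christoffel symbols of the first kind:
`(u, v, w) ↦ (1/2) (D_u G(v, w) + D_v G(u, w) - D_w G(u, v))` at the point `y`. -/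
def christoffelFirst (G : E → E →L[ℝ] E →L[ℝ] ℝ) (y : E) : E →L[ℝ] E →L[ℝ] E →L[ℝ] ℝ :=
  (2⁻¹ : ℝ) • (fderiv ℝ G y + (fderiv ℝ G y).flip - rotate (fderiv ℝ G y))

theorem christoffelFirst_apply (G : E → E →L[ℝ] E →L[ℝ] ℝ) (y u v w : E) :
    christoffelFirst G y u v w =
      (2⁻¹ : ℝ) * (fderiv ℝ G y u v w + fderiv ℝ G y v u w - fderiv ℝ G y w u v) := by
  simp [christoffelFirst, rotate]

/-- Christoffel symbols of the second kind: `christoffel G y u v` is the covariant derivative at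
`y`, in the direction `u`, of the constant vector field `v` for the Levi-Civita connection of `G`.
It is the vector `c` with `G y c w = christoffelFirst G y u v w` for all `w`. -/
def christoffel (G : E → E →L[ℝ] E →L[ℝ] ℝ) (y : E) : E →L[ℝ] E →L[ℝ] E :=
  ContinuousLinearMap.compL ℝ E (E →L[ℝ] ℝ) E (G y).inverse ∘L christoffelFirst G y

theorem christoffel_spec (G : E → E →L[ℝ] E →L[ℝ] ℝ) (y : E) (hG : (G y).IsInvertible)
    (u v w : E) : G y (christoffel G y u v) w = christoffelFirst G y u v w := by
  have h : G y ((G y).inverse (christoffelFirst G y u v)) = christoffelFirst G y u v := by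
    rw [← ContinuousLinearMap.comp_apply, hG.self_comp_inverse]; rfl
  exact congrArg (fun f : E →L[ℝ] ℝ => f w) h

/-- The Riemann curvature `R(u, v)w = ∇_u ∇_v w - ∇_v ∇_u w` at `y`, for constant vector fields
`u, v, w`. -/
def curvature (G : E → E →L[ℝ] E →L[ℝ] ℝ) (y u v w : E) : E :=
  fderiv ℝ (christoffel G) y u v w - fderiv ℝ (christoffel G) y v u w
    + christoffel G y u (christoffel G y v w) - christoffel G y v (christoffel G y u w)

theorem curvature_add (G : E → E →L[ℝ] E →L[ℝ] ℝ) (y u u' v w : E) :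
    curvature G y (u + u') v w = curvature G y u v w + curvature G y u' v w := by
  simp only [curvature, map_add, _root_.add_apply]
  abel

theorem curvature_smul (G : E → E →L[ℝ] E →L[ℝ] ℝ) (y : E) (c : ℝ) (u v w : E) :
    curvature G y (c • u) v w = c • curvature G y u v w := by
  simp only [curvature, map_smul, _root_.smul_apply, smul_sub, smul_add]

theorem curvature_zero (G : E → E →L[ℝ] E →L[ℝ] ℝ) (y v w : E) :
    curvature G y 0 v w = 0 := by
  simp [curvature]

end MetricInCoordinates

/-! ### Riemannian manifolds -/

namespace RiemannianGeometry

open Bundle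

variable {n : ℕ} {M : Type*} [TopologicalSpace M] [ChartedSpace (EuclideanSpace ℝ (Fin n)) M]
  [IsManifold (𝓡 n) ∞ M]

/-- The differential at `x` of the preferred chart `φ` of `M` at `x`. -/
def chartDeriv (n : ℕ) {M : Type*} [TopologicalSpace M]
    [ChartedSpace (EuclideanSpace ℝ (Fin n)) M] (x : M) :
    TangentSpace (𝓡 n) x →L[ℝ] EuclideanSpace ℝ (Fin n) :=
  mfderiv (𝓡 n) 𝓘(ℝ, EuclideanSpace ℝ (Fin n)) (extChartAt (𝓡 n) x) x

/-- The differential at `y` of the inverse of the preferred chart `φ` of `M` at `x`. -/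
def chartSymmDeriv (n : ℕ) {M : Type*} [TopologicalSpace M]
    [ChartedSpace (EuclideanSpace ℝ (Fin n)) M] (x : M) (y : EuclideanSpace ℝ (Fin n)) :
    EuclideanSpace ℝ (Fin n) →L[ℝ] TangentSpace (𝓡 n) ((extChartAt (𝓡 n) x).symm y) :=
  mfderiv 𝓘(ℝ, EuclideanSpace ℝ (Fin n)) (𝓡 n) (extChartAt (𝓡 n) x).symm y

/-- A Riemannian metric `h` read in the preferred chart `φ` of `M` at `x`: the pull-back of `h` by
`φ⁻¹`. -/
def metricInChart
    (h : ContMDiffRiemannianMetric (𝓡 n) ∞ (EuclideanSpace ℝ (Fin n))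
      (fun x : M => TangentSpace (𝓡 n) x)) (x : M) (y : EuclideanSpace ℝ (Fin n)) :
    EuclideanSpace ℝ (Fin n) →L[ℝ] EuclideanSpace ℝ (Fin n) →L[ℝ] ℝ :=
  (ContinuousLinearMap.precomp ℝ (chartSymmDeriv n x y)).comp
    ((h.inner ((extChartAt (𝓡 n) x).symm y)).comp (chartSymmDeriv n x y))

theorem metricInChart_apply
    (h : ContMDiffRiemannianMetric (𝓡 n) ∞ (EuclideanSpace ℝ (Fin n))
      (fun x : M => TangentSpace (𝓡 n) x)) (x : M) (y u v : EuclideanSpace ℝ (Fin n)) :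
    metricInChart h x y u v = h.inner ((extChartAt (𝓡 n) x).symm y)
      (chartSymmDeriv n x y u) (chartSymmDeriv n x y v) := rfl

/-- The curvature tensor `R(X, Y)Z` of the Riemannian manifold `(M, h)` at `x`, computed in the
preferred chart at `x` (it does not depend on the chart, as `R` is a tensor). The result is the
coordinate expression of the tangent vector `R(X, Y)Z`. -/
def curvatureInChart
    (h : ContMDiffRiemannianMetric (𝓡 n) ∞ (EuclideanSpace ℝ (Fin n))
      (fun x : M => TangentSpace (𝓡 n) x)) (x : M) (X Y Z : TangentSpace (𝓡 n) x) :
    EuclideanSpace ℝ (Fin n) :=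
  MetricInCoordinates.curvature (metricInChart h x) (extChartAt (𝓡 n) x x)
    (chartDeriv n x X) (chartDeriv n x Y) (chartDeriv n x Z)

/-- The nullity `Γ(x) = {X ∈ T_x M | R(X, Y) = 0 for all Y ∈ T_x M}` of `(M, h)` at `x`. -/
def nullity
    (h : ContMDiffRiemannianMetric (𝓡 n) ∞ (EuclideanSpace ℝ (Fin n))
      (fun x : M => TangentSpace (𝓡 n) x)) (x : M) : Submodule ℝ (TangentSpace (𝓡 n) x) where
  carrier := {X | ∀ Y Z : TangentSpace (𝓡 n) x, curvatureInChart h x X Y Z = 0}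
  add_mem' := fun {X X'} hX hX' Y Z => by
    have e : curvatureInChart h x (X + X') Y Z
        = curvatureInChart h x X Y Z + curvatureInChart h x X' Y Z := by
      unfold curvatureInChart
      rw [map_add, MetricInCoordinates.curvature_add]
    rw [e, hX Y Z, hX' Y Z, add_zero]
  zero_mem' := fun Y Z => by
    unfold curvatureInChart
    rw [map_zero, MetricInCoordinates.curvature_zero]
  smul_mem' := fun c X hX Y Z => by
    have e : curvatureInChart h x (c • X) Y Z = c • curvatureInChart h x X Y Z := by
      unfold curvatureInChart
      rw [map_smul, MetricInCoordinates.curvature_smul]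
    rw [e, hX Y Z, smul_zero]

/-- The differential `g_* : T_x M → F` of a map `g : M → F`. -/
def differential (n : ℕ) {M : Type*} [TopologicalSpace M]
    [ChartedSpace (EuclideanSpace ℝ (Fin n)) M] {F : Type*} [NormedAddCommGroup F]
    [NormedSpace ℝ F] (g : M → F) (x : M) : TangentSpace (𝓡 n) x →ₗ[ℝ] F :=
  (show TangentSpace (𝓡 n) x →L[ℝ] F from mfderiv (𝓡 n) 𝓘(ℝ, F) g x).toLinearMap

/-- `g : M → F` is an isometric immersion of the Riemannian manifold `(M, h)` into the Euclidean
space `F`: it is smooth and its differentials preserve inner products. -/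
structure IsIsometricImmersion {F : Type*} [NormedAddCommGroup F] [InnerProductSpace ℝ F]
    (h : ContMDiffRiemannianMetric (𝓡 n) ∞ (EuclideanSpace ℝ (Fin n))
      (fun x : M => TangentSpace (𝓡 n) x)) (g : M → F) : Prop where
  contMDiff : ContMDiff (𝓡 n) 𝓘(ℝ, F) ∞ g
  inner_eq : ∀ (x : M) (X Y : TangentSpace (𝓡 n) x),
    inner ℝ (differential n g x X) (differential n g x Y) = h.inner x X Y

/-- The normal space of `g` at `x`: the orthogonal complement of `g_* T_x M`. -/
def normalSpace (n : ℕ) {M : Type*} [TopologicalSpace M]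
    [ChartedSpace (EuclideanSpace ℝ (Fin n)) M] {F : Type*} [NormedAddCommGroup F]
    [InnerProductSpace ℝ F] (g : M → F) (x : M) : Submodule ℝ F :=
  (LinearMap.range (differential n g x))ᗮ

/-- The second fundamental form `α : T_x M × T_x M → T_x^⊥ M` of `g` at `x`: `α(X, Y)` is the
normal component of the derivative, in the direction `X`, of `g_* Y`, where `Y` is extended to the
vector field that is constant in the preferred chart `φ` at `x`; this derivative is the second
derivative of `g ∘ φ⁻¹`, evaluated at the coordinates of `X` and `Y`. -/
def secondFundamentalForm (n : ℕ) {M : Type*} [TopologicalSpace M]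
    [ChartedSpace (EuclideanSpace ℝ (Fin n)) M] {F : Type*} [NormedAddCommGroup F]
    [InnerProductSpace ℝ F] [FiniteDimensional ℝ F] (g : M → F) (x : M) :
    TangentSpace (𝓡 n) x →ₗ[ℝ] TangentSpace (𝓡 n) x →ₗ[ℝ] normalSpace n g x :=
  LinearMap.mk₂ ℝ
    (fun X Y => (normalSpace n g x).orthogonalProjectionOnto
      (fderiv ℝ (fderiv ℝ (g ∘ (extChartAt (𝓡 n) x).symm)) (extChartAt (𝓡 n) x x)
        (chartDeriv n x X) (chartDeriv n x Y)))
    (fun X X' Y => by simp only [map_add, _root_.add_apply])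
    (fun c X Y => by simp only [map_smul, _root_.smul_apply])
    (fun X Y Y' => by simp only [map_add])
    (fun c X Y => by simp only [map_smul])

/-- The relative nullity `Δ_g(x)` of `g` at `x`: the nullity of its second fundamental form. -/
def relativeNullity (n : ℕ) {M : Type*} [TopologicalSpace M]
    [ChartedSpace (EuclideanSpace ℝ (Fin n)) M] {F : Type*} [NormedAddCommGroup F]
    [InnerProductSpace ℝ F] [FiniteDimensional ℝ F] (g : M → F) (x : M) :
    Submodule ℝ (TangentSpace (𝓡 n) x) :=
  BilinearMap.leftNullity (secondFundamentalForm n g x)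

/-- `β = α|_{TM × Γ}` at the point `x`. -/
def restrictedForm {F : Type*} [NormedAddCommGroup F]
    [InnerProductSpace ℝ F] [FiniteDimensional ℝ F]
    (h : ContMDiffRiemannianMetric (𝓡 n) ∞ (EuclideanSpace ℝ (Fin n))
      (fun x : M => TangentSpace (𝓡 n) x)) (g : M → F) (x : M) :
    TangentSpace (𝓡 n) x →ₗ[ℝ] nullity h x →ₗ[ℝ] normalSpace n g x :=
  (secondFundamentalForm n g x).compl₂ (nullity h x).subtype

end RiemannianGeometry

end

/-!
For `Z` in the nullity `Γ`, the Gauss equation reads `⟨α(X, Z), α(Y, T)⟩ = ⟨α(X, T), α(Y, Z)⟩`; in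
particular `β = α|_{TM × Γ}` is flat. Choose `X₀` with `β(X₀, ·)` of maximal rank `r ≤ dim S(β)`.
Perturbing `X₀` to `X₀ + tX` cannot raise the rank, so every `β(X, ·)` maps `ker β(X₀, ·)` into the
image of `β(X₀, ·)`. If `β(X₀, Z) = 0` and `β(X, Z) = β(X₀, T)`, flatness gives
`|β(X, Z)|² = ⟨β(X, Z), β(X₀, T)⟩ = ⟨β(X, T), β(X₀, Z)⟩ = 0`; hence `ker β(X₀, ·)` consists of
relative nullity vectors, and `μ - ν ≤ r`.

The flip of `β` is flat too, so the `X` with `β(X, ·) = 0` form a space of dimension at least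
`n - dim S(β)`. For such `X` the Gauss equation makes every `α(X, Y)` orthogonal to `S(β)`. If
`S(β)` were the whole normal space, these `X` would lie in the relative nullity, so `ν ≥ n - p`.

The Gauss equation itself is obtained in a chart: there `α` is the covariant Hessian of the
immersion `f`, and differentiating the orthogonality of `∇df(v, w)` to the image of `df` computes
the tangential part of the derivative of `∇df`; antisymmetrizing produces the curvature.
-/

noncomputable section

namespace BilinearMap

open Module

section Regular

open Polynomial

variable {K V U W : Type*} [Field K] [AddCommGroup V] [Module K V] [AddCommGroup U] [Module K U]
  [AddCommGroup W] [Module K W]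

theorem finite_setOf_not_linearIndependent_add_smul {ι : Type*} [Finite ι] {v : ι → W}
    (hv : LinearIndependent K v) (w : ι → W) :
    {t : K | ¬LinearIndependent K fun i => v i + t • w i}.Finite := by
  classical
  have := Fintype.ofFinite ι
  obtain ⟨P, hP⟩ := (Fintype.linearCombination K v).exists_leftInverse_of_injective
    (LinearMap.ker_eq_bot.2 hv.fintypeLinearCombination_injective)
  -- In the coordinates `P`, the family is the matrix `1 + t M`, whose determinant is a polynomial
  -- in `t` with constant term `1`.
  let M : Matrix ι ι K := Matrix.of fun i => P (w i)
  let q : K[X] := (1 + (X : K[X]) • M.map C).det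
  have hrow (t : K) : P ∘ (fun i => v i + t • w i) = (1 + t • M).row := by
    ext i j
    have hPv : P (v i) = Pi.single i 1 := by
      simpa using LinearMap.congr_fun hP (Pi.single i 1)
    simp [M, hPv, Matrix.one_apply, Pi.single_apply, eq_comm]
  have hq (t : K) : q.eval t = (1 + t • M).det := by
    rw [← coe_evalRingHom, RingHom.map_det]
    congr 1
    ext i j
    simp [Matrix.one_apply, apply_ite, mul_comm (M i j)]
  have hq0 : q ≠ 0 := fun h => by simpa [h] using hq 0
  refine (finite_setOfPred_isRoot hq0).subset fun t ht => ?_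
  by_contra hroot
  have hdet : (1 + t • M).det ≠ 0 := fun h => hroot ((hq t).trans h)
  have hli := Matrix.linearIndependent_rows_of_det_ne_zero hdet
  exact ht (LinearIndependent.of_comp P (hrow t ▸ hli))

theorem map_ker_le_range_of_finrank_range_add_smul_le [Infinite K] [FiniteDimensional K W]
    {f g : U →ₗ[K] W}
    (hfg : ∀ t : K, finrank K (LinearMap.range (f + t • g)) ≤ finrank K (LinearMap.range f)) :
    (LinearMap.ker f).map g ≤ LinearMap.range f := by
  rintro _ ⟨z, hz, rfl⟩
  by_contra hgz
  let b := finBasis K (LinearMap.range f)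
  choose e he using fun i => (b i).2
  have hfe : LinearIndependent K (f ∘ e) := by
    rw [show f ∘ e = _ from funext he]
    exact b.linearIndependent.map' _ (Submodule.ker_subtype _)
  have hspan : Submodule.span K (Set.range (f ∘ e)) ≤ LinearMap.range f :=
    Submodule.span_le.2 (Set.range_subset_iff.2 fun i => ⟨e i, rfl⟩)
  have hv : LinearIndependent K (Fin.cons (g z) (f ∘ e) : Fin (_ + 1) → W) :=
    hfe.finCons fun h => hgz (hspan h)
  obtain ⟨t, ht⟩ := ((finite_setOf_not_linearIndependent_add_smul hv
    (Fin.cons 0 (g ∘ e))).insert 0).infinite_compl.nonempty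
  obtain ⟨ht0, hli⟩ : t ≠ 0 ∧ LinearIndependent K _ := by simpa using ht
  -- `g z = (f + t g) (t⁻¹ z)`, so `f + t g` has larger rank than `f`.
  have hmem : Set.range (fun i => (Fin.cons (g z) (f ∘ e) : Fin (_ + 1) → W) i
      + t • (Fin.cons 0 (g ∘ e) : Fin (_ + 1) → W) i) ⊆ LinearMap.range (f + t • g) := by
    refine Set.range_subset_iff.2 (Fin.cases ⟨t⁻¹ • z, ?_⟩ fun i => ⟨e i, by simp⟩)
    simp [LinearMap.mem_ker.1 hz, ht0]
  have hcard := Submodule.finrank_mono (Submodule.span_le.2 hmem)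
  rw [finrank_span_eq_card hli, Fintype.card_fin] at hcard
  exact absurd (hcard.trans (hfg t)) (Nat.not_succ_le_self _)

/-- `X` is a regular element of the bilinear map `β` if the partial map `β X` has the largest
possible rank. -/
def IsRegular (β : V →ₗ[K] U →ₗ[K] W) (X : V) : Prop :=
  ∀ Y, finrank K (LinearMap.range (β Y)) ≤ finrank K (LinearMap.range (β X))

variable [FiniteDimensional K W]

theorem exists_isRegular (β : V →ₗ[K] U →ₗ[K] W) : ∃ X, IsRegular β X := by
  have hfin : (Set.range fun X => finrank K (LinearMap.range (β X))).Finite :=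
    (Set.finite_Iic (finrank K W)).subset
      (Set.range_subset_iff.2 fun X => Submodule.finrank_le _)
  obtain ⟨_, ⟨X, rfl⟩, hX⟩ := Set.exists_max_image _ id hfin (Set.range_nonempty _)
  exact ⟨X, fun Y => hX _ ⟨Y, rfl⟩⟩

theorem IsRegular.apply_mem_range [Infinite K] {β : V →ₗ[K] U →ₗ[K] W} {X₀ : V}
    (hX₀ : IsRegular β X₀) (X : V) {Z : U} (hZ : β X₀ Z = 0) :
    β X Z ∈ LinearMap.range (β X₀) :=
  map_ker_le_range_of_finrank_range_add_smul_le
    (fun t => by rw [← map_smul, ← map_add]; exact hX₀ _) ⟨Z, hZ, rfl⟩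

end Regular

section ValueSpan

variable {V U W : Type*} [AddCommGroup V] [Module ℝ V] [AddCommGroup U] [Module ℝ U]
  [AddCommGroup W] [Module ℝ W] (β : V →ₗ[ℝ] U →ₗ[ℝ] W)

theorem range_le_valueSpan (X : V) : LinearMap.range (β X) ≤ valueSpan β := by
  rintro _ ⟨Y, rfl⟩
  exact Submodule.subset_span ⟨X, Y, rfl⟩

theorem valueSpan_flip : valueSpan β.flip = valueSpan β :=
  congrArg (Submodule.span ℝ) (Set.ext fun _ => exists_comm)

end ValueSpan

section Flat

variable {V U W : Type*} [AddCommGroup V] [Module ℝ V] [AddCommGroup U] [Module ℝ U]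
  [NormedAddCommGroup W] [InnerProductSpace ℝ W]

/-- A bilinear map `β : V × U → W` into a Euclidean space is flat if
`⟨β(X, Z), β(Y, T)⟩ = ⟨β(X, T), β(Y, Z)⟩`. -/
def IsFlat (β : V →ₗ[ℝ] U →ₗ[ℝ] W) : Prop :=
  ∀ X Y Z T, inner ℝ (β X Z) (β Y T) = inner ℝ (β X T) (β Y Z)

namespace IsFlat

variable {β : V →ₗ[ℝ] U →ₗ[ℝ] W}

theorem flip (hβ : IsFlat β) : IsFlat β.flip := fun Z T X Y => by
  simpa only [LinearMap.flip_apply, real_inner_comm] using hβ X Y Z T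

variable [FiniteDimensional ℝ W]

theorem ker_le_leftNullity_flip (hβ : IsFlat β) {X₀ : V} (hX₀ : IsRegular β X₀) :
    LinearMap.ker (β X₀) ≤ leftNullity β.flip := by
  intro Z hZ X
  obtain ⟨T, hT⟩ := hX₀.apply_mem_range X hZ
  have hXZ : inner ℝ (β X Z) (β X₀ T) = 0 := by
    rw [hβ X X₀ Z T, LinearMap.mem_ker.1 hZ, inner_zero_right]
  rwa [hT, inner_self_eq_zero] at hXZ

theorem finrank_right_le [FiniteDimensional ℝ U] (hβ : IsFlat β) :
    finrank ℝ U ≤ finrank ℝ (leftNullity β.flip) + finrank ℝ (valueSpan β) := by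
  obtain ⟨X₀, hX₀⟩ := exists_isRegular β
  calc finrank ℝ U
      = finrank ℝ (LinearMap.ker (β X₀)) + finrank ℝ (LinearMap.range (β X₀)) := by
        rw [add_comm, LinearMap.finrank_range_add_finrank_ker]
    _ ≤ finrank ℝ (leftNullity β.flip) + finrank ℝ (valueSpan β) :=
        add_le_add (Submodule.finrank_mono (hβ.ker_le_leftNullity_flip hX₀))
          (Submodule.finrank_mono (range_le_valueSpan β X₀))

theorem finrank_left_le [FiniteDimensional ℝ V] (hβ : IsFlat β) :
    finrank ℝ V ≤ finrank ℝ (leftNullity β) + finrank ℝ (valueSpan β) := by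
  rw [← valueSpan_flip β]
  exact hβ.flip.finrank_right_le

end IsFlat

/-- `α` is flat along `N` if `⟨α(X, Z), α(Y, T)⟩ = ⟨α(X, T), α(Y, Z)⟩` for all `Z ∈ N`. When `α` is
a second fundamental form, the Gauss equation says that this holds for `N` the nullity of the
curvature tensor. -/
def IsFlatAlong (α : V →ₗ[ℝ] V →ₗ[ℝ] W) (N : Submodule ℝ V) : Prop :=
  ∀ Z ∈ N, ∀ X Y T, inner ℝ (α X Z) (α Y T) = inner ℝ (α X T) (α Y Z)

namespace IsFlatAlong

variable {α : V →ₗ[ℝ] V →ₗ[ℝ] W} {N : Submodule ℝ V}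

theorem isFlat_compl₂_subtype (hα : IsFlatAlong α N) : IsFlat (α.compl₂ N.subtype) :=
  fun X Y Z T => hα Z Z.2 X Y T

theorem apply_mem_orthogonal_valueSpan (hα : IsFlatAlong α N) {X : V}
    (hX : X ∈ leftNullity (α.compl₂ N.subtype)) (Y : V) :
    α X Y ∈ (valueSpan (α.compl₂ N.subtype))ᗮ := by
  suffices h : (ℝ ∙ α X Y) ⟂ valueSpan (α.compl₂ N.subtype) from
    h (Submodule.mem_span_singleton_self _)
  refine Submodule.isOrtho_span.2 ?_
  rintro _ rfl _ ⟨T, Z, rfl⟩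
  have hXZ : α X Z = 0 := hX Z
  have hflat := hα Z Z.2 X T Y
  rw [hXZ, inner_zero_left] at hflat
  exact hflat.symm

variable [FiniteDimensional ℝ V] [FiniteDimensional ℝ W]

theorem finrank_le_leftNullity_add_valueSpan (hα : IsFlatAlong α N)
    (hsymm : ∀ X Y, α X Y = α Y X) :
    finrank ℝ N ≤ finrank ℝ (leftNullity α) + finrank ℝ (valueSpan (α.compl₂ N.subtype)) := by
  have hmap : (leftNullity (α.compl₂ N.subtype).flip).map N.subtype ≤ leftNullity α := by
    rintro _ ⟨Z, hZ, rfl⟩ Y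
    exact (hsymm _ _).trans (hZ Y)
  refine hα.isFlat_compl₂_subtype.finrank_right_le.trans (Nat.add_le_add_right ?_ _)
  simpa only [Submodule.finrank_map_subtype_eq] using Submodule.finrank_mono hmap

theorem finrank_valueSpan_lt (hα : IsFlatAlong α N)
    (hlt : finrank ℝ (leftNullity α) + finrank ℝ W < finrank ℝ V) :
    finrank ℝ (valueSpan (α.compl₂ N.subtype)) < finrank ℝ W := by
  refine Submodule.finrank_lt fun htop => hlt.not_ge ?_
  have hle : leftNullity (α.compl₂ N.subtype) ≤ leftNullity α := fun X hX Y => by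
    simpa [htop] using hα.apply_mem_orthogonal_valueSpan hX Y
  calc finrank ℝ V
      ≤ finrank ℝ (leftNullity (α.compl₂ N.subtype))
        + finrank ℝ (valueSpan (α.compl₂ N.subtype)) := hα.isFlat_compl₂_subtype.finrank_left_le
    _ ≤ finrank ℝ (leftNullity α) + finrank ℝ W :=
        add_le_add (Submodule.finrank_mono hle) (Submodule.finrank_le _)

end IsFlatAlong

end Flat

end BilinearMap

namespace MetricInCoordinates

open Topology ContinuousLinearMap

variable {E F : Type*} [NormedAddCommGroup E] [NormedSpace ℝ E]

theorem hasFDerivAt_fderiv [NormedAddCommGroup F] [NormedSpace ℝ F] {f : E → F} {y : E}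
    (hf : ContDiffAt ℝ 2 f y) : HasFDerivAt (fderiv ℝ f) (fderiv ℝ (fderiv ℝ f) y) y :=
  ((hf.fderiv_right (m := 1) one_add_one_eq_two.le).differentiableAt one_ne_zero).hasFDerivAt

section Regularity

variable {G G' : E → E →L[ℝ] E →L[ℝ] ℝ} {y : E}

theorem christoffel_congr (h : G =ᶠ[𝓝 y] G') : christoffel G y = christoffel G' y := by
  simp only [christoffel, christoffelFirst, h.fderiv_eq, h.eq_of_nhds]

theorem curvature_congr (h : G =ᶠ[𝓝 y] G') (u v w : E) :
    curvature G y u v w = curvature G' y u v w := by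
  have hc : christoffel G =ᶠ[𝓝 y] christoffel G' := by
    filter_upwards [h.eventuallyEq_nhds] with z hz using christoffel_congr hz
  simp only [curvature, hc.fderiv_eq, hc.eq_of_nhds]

variable {m k : ℕ∞ω}

theorem contDiffAt_christoffelFirst (hG : ContDiffAt ℝ k G y) (hmk : m + 1 ≤ k) :
    ContDiffAt ℝ m (christoffelFirst G) y := by
  have hG' : ContDiffAt ℝ m (fderiv ℝ G) y := hG.fderiv_right hmk
  have hflip : ContDiffAt ℝ m (fun z => (fderiv ℝ G z).flip) y :=
    (flipₗᵢ ℝ E E (E →L[ℝ] ℝ)).toContinuousLinearEquiv.contDiff.contDiffAt.comp y hG'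
  have hrotate : ContDiffAt ℝ m (fun z => rotate (fderiv ℝ G z)) y :=
    contDiffAt_const.clm_comp hflip
  exact ((hG'.add hflip).sub hrotate).const_smul _

theorem contDiffAt_christoffel [CompleteSpace E] (hG : ContDiffAt ℝ k G y)
    (hinv : (G y).IsInvertible) (hmk : m + 1 ≤ k) : ContDiffAt ℝ m (christoffel G) y := by
  have hinverse : ContDiffAt ℝ m (fun z => (G z).inverse) y :=
    hinv.contDiffAt_map_inverse.comp y (hG.of_le (le_self_add.trans hmk))
  exact ((compL ℝ E (E →L[ℝ] ℝ) E).contDiff.contDiffAt.comp y hinverse).clm_comp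
    (contDiffAt_christoffelFirst hG hmk)

end Regularity

variable [NormedAddCommGroup F] [InnerProductSpace ℝ F]

/-- The metric on `E` induced by a map `f : E → F` into a Euclidean space: the pull-back of the
inner product of `F` by `f`. -/
def inducedMetric (f : E → F) (y : E) : E →L[ℝ] E →L[ℝ] ℝ :=
  ((compL ℝ E F ℝ).flip (fderiv ℝ f y)).comp ((innerSL ℝ).comp (fderiv ℝ f y))

theorem inducedMetric_apply (f : E → F) (y u v : E) :
    inducedMetric f y u v = inner ℝ (fderiv ℝ f y u) (fderiv ℝ f y v) := rfl

/-- The covariant Hessian `∇df` of `f` for the Levi-Civita connection of the metric induced by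
`f`. When `f` is an immersion it is the second fundamental form of `f`. -/
def covariantHessian (f : E → F) (y u v : E) : F :=
  fderiv ℝ (fderiv ℝ f) y u v - fderiv ℝ f y (christoffel (inducedMetric f) y u v)

variable {f : E → F} {y : E}

theorem contDiffAt_inducedMetric {m k : ℕ∞ω} (hf : ContDiffAt ℝ k f y) (hmk : m + 1 ≤ k) :
    ContDiffAt ℝ m (inducedMetric f) y := by
  have hf' : ContDiffAt ℝ m (fderiv ℝ f) y := hf.fderiv_right hmk
  have hcomp : ContDiffAt ℝ m (fun z => (compL ℝ E F ℝ).flip (fderiv ℝ f z)) y :=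
    ((compL ℝ E F ℝ).flip).contDiff.contDiffAt.comp y hf'
  exact hcomp.clm_comp (contDiffAt_const.clm_comp hf')

theorem fderiv_inducedMetric_apply (hf : ContDiffAt ℝ 2 f y) (u v w : E) :
    fderiv ℝ (inducedMetric f) y u v w =
      inner ℝ (fderiv ℝ (fderiv ℝ f) y u v) (fderiv ℝ f y w)
        + inner ℝ (fderiv ℝ f y v) (fderiv ℝ (fderiv ℝ f) y u w) := by
  have hf' := hasFDerivAt_fderiv hf
  have hG : HasFDerivAt (inducedMetric f) (fderiv ℝ (inducedMetric f) y) y :=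
    ((contDiffAt_inducedMetric hf one_add_one_eq_two.le).differentiableAt one_ne_zero).hasFDerivAt
  have hleft := (hG.clm_apply (hasFDerivAt_const v y)).clm_apply (hasFDerivAt_const w y)
  have hright := (hf'.clm_apply (hasFDerivAt_const v y)).inner ℝ
    (hf'.clm_apply (hasFDerivAt_const w y))
  simpa [add_comm] using congrArg (fun T => T u) (hleft.unique hright)

theorem christoffelFirst_inducedMetric (hf : ContDiffAt ℝ 2 f y) (u v w : E) :
    christoffelFirst (inducedMetric f) y u v w =
      inner ℝ (fderiv ℝ (fderiv ℝ f) y u v) (fderiv ℝ f y w) := by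
  have hsymm : IsSymmSndFDerivAt ℝ f y := hf.isSymmSndFDerivAt (by simp)
  simp only [christoffelFirst_apply, fderiv_inducedMetric_apply hf]
  rw [hsymm.eq v u, hsymm.eq w u, hsymm.eq w v,
    real_inner_comm (fderiv ℝ (fderiv ℝ f) y u w), real_inner_comm (fderiv ℝ (fderiv ℝ f) y v w)]
  ring

theorem inner_christoffel_inducedMetric (hf : ContDiffAt ℝ 2 f y)
    (hinv : (inducedMetric f y).IsInvertible) (u v w : E) :
    inner ℝ (fderiv ℝ f y (christoffel (inducedMetric f) y u v)) (fderiv ℝ f y w) =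
      inner ℝ (fderiv ℝ (fderiv ℝ f) y u v) (fderiv ℝ f y w) := by
  rw [← inducedMetric_apply, christoffel_spec _ _ hinv, christoffelFirst_inducedMetric hf]

theorem inner_covariantHessian_fderiv (hf : ContDiffAt ℝ 2 f y)
    (hinv : (inducedMetric f y).IsInvertible) (u v w : E) :
    inner ℝ (covariantHessian f y u v) (fderiv ℝ f y w) = 0 := by
  rw [covariantHessian, inner_sub_left, inner_christoffel_inducedMetric hf hinv, sub_self]

theorem isInvertible_inducedMetric [FiniteDimensional ℝ E]
    (hinj : Function.Injective (fderiv ℝ f y)) : (inducedMetric f y).IsInvertible := by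
  have hinj' : Function.Injective (inducedMetric f y) := by
    refine (injective_iff_map_eq_zero _).2 fun u hu => hinj ?_
    have huu : inner ℝ (fderiv ℝ f y u) (fderiv ℝ f y u) = 0 := congrArg (fun T => T u) hu
    rw [map_zero, inner_self_eq_zero.1 huu]
  have hdim : Module.finrank ℝ E = Module.finrank ℝ (E →L[ℝ] ℝ) := by
    rw [← LinearMap.toContinuousLinearMap.finrank_eq]
    exact Subspace.dual_finrank_eq.symm
  exact ⟨(LinearEquiv.ofInjectiveOfFinrankEq _ hinj' hdim).toContinuousLinearEquiv, rfl⟩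

section Gauss

variable [CompleteSpace E]

theorem eventually_isInvertible_inducedMetric (hf : ContDiffAt ℝ 1 f y)
    (hinv : (inducedMetric f y).IsInvertible) : ∀ᶠ z in 𝓝 y, (inducedMetric f z).IsInvertible := by
  obtain ⟨e, he⟩ := hinv
  exact (contDiffAt_inducedMetric hf (m := 0) (zero_add 1).le).continuousAt.eventually
    (he ▸ ContinuousLinearEquiv.nhds e)

theorem hasFDerivAt_covariantHessian (hf : ContDiffAt ℝ 3 f y)
    (hinv : (inducedMetric f y).IsInvertible) (v w : E) :
    HasFDerivAt (fun z => covariantHessian f z v w)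
      (((fderiv ℝ (fderiv ℝ (fderiv ℝ f)) y).flip v).flip w
        - ((fderiv ℝ (fderiv ℝ f) y).flip (christoffel (inducedMetric f) y v w)
          + fderiv ℝ f y ∘L ((fderiv ℝ (christoffel (inducedMetric f)) y).flip v).flip w)) y := by
  have hf' := hasFDerivAt_fderiv (hf.of_le (by norm_num))
  have hf'' := hasFDerivAt_fderiv (hf.fderiv_right (m := 2) two_add_one_eq_three.le)
  have hΓ : HasFDerivAt (christoffel (inducedMetric f))
      (fderiv ℝ (christoffel (inducedMetric f)) y) y :=
    ((contDiffAt_christoffel (contDiffAt_inducedMetric hf two_add_one_eq_three.le) hinv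
      one_add_one_eq_two.le).differentiableAt one_ne_zero).hasFDerivAt
  have hv := hasFDerivAt_const (𝕜 := ℝ) v y
  have hw := hasFDerivAt_const (𝕜 := ℝ) w y
  refine (((hf''.clm_apply hv).clm_apply hw).sub
    (hf'.clm_apply ((hΓ.clm_apply hv).clm_apply hw))).congr_fderiv ?_
  ext u
  simp [add_comm]

theorem inner_fderiv_covariantHessian_fderiv (hf : ContDiffAt ℝ 3 f y)
    (hinv : (inducedMetric f y).IsInvertible) (u v w t : E) :
    inner ℝ (fderiv ℝ (fun z => covariantHessian f z v w) y u) (fderiv ℝ f y t) =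
      -inner ℝ (covariantHessian f y v w) (covariantHessian f y u t) := by
  have hf₂ : ContDiffAt ℝ 2 f y := hf.of_le (by norm_num)
  -- Differentiate the orthogonality of `∇df(v, w)` and `df(t)` in the direction `u`.
  have hnormal : (fun z => inner ℝ (covariantHessian f z v w) (fderiv ℝ f z t)) =ᶠ[𝓝 y] 0 := by
    filter_upwards [hf₂.eventually (by simp),
      eventually_isInvertible_inducedMetric (hf.of_le (by norm_num)) hinv] with z hz hinvz
    exact inner_covariantHessian_fderiv hz hinvz v w t
  have hderiv := ((hasFDerivAt_covariantHessian hf hinv v w).differentiableAt.hasFDerivAt.inner ℝ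
    ((hasFDerivAt_fderiv hf₂).clm_apply (hasFDerivAt_const t y))).unique
    ((hasFDerivAt_const (0 : ℝ) y).congr_of_eventuallyEq hnormal)
  have hsum : inner ℝ (covariantHessian f y v w) (fderiv ℝ (fderiv ℝ f) y u t)
      + inner ℝ (fderiv ℝ (fun z => covariantHessian f z v w) y u) (fderiv ℝ f y t) = 0 := by
    simpa using congrArg (fun T => T u) hderiv
  rw [covariantHessian.eq_def f y u t, inner_sub_right, inner_covariantHessian_fderiv hf₂ hinv]
  linarith

theorem inner_fderiv_christoffel_add (hf : ContDiffAt ℝ 3 f y)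
    (hinv : (inducedMetric f y).IsInvertible) (u v w t : E) :
    inner ℝ (fderiv ℝ f y (fderiv ℝ (christoffel (inducedMetric f)) y u v w
        + christoffel (inducedMetric f) y u (christoffel (inducedMetric f) y v w)))
        (fderiv ℝ f y t) =
      inner ℝ (fderiv ℝ (fderiv ℝ (fderiv ℝ f)) y u v w) (fderiv ℝ f y t)
        + inner ℝ (covariantHessian f y v w) (covariantHessian f y u t) := by
  have hweingarten := inner_fderiv_covariantHessian_fderiv hf hinv u v w t
  have htangent := inner_christoffel_inducedMetric (hf.of_le (by norm_num)) hinv u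
    (christoffel (inducedMetric f) y v w) t
  rw [(hasFDerivAt_covariantHessian hf hinv v w).fderiv] at hweingarten
  simp only [sub_apply, add_apply, flip_apply, comp_apply, inner_sub_left, inner_add_left,
    map_add] at hweingarten ⊢
  linarith

theorem gauss_equation (hf : ContDiffAt ℝ 3 f y) (hinv : (inducedMetric f y).IsInvertible)
    (u v w t : E) :
    inner ℝ (fderiv ℝ f y (curvature (inducedMetric f) y u v w)) (fderiv ℝ f y t) =
      inner ℝ (covariantHessian f y v w) (covariantHessian f y u t)
        - inner ℝ (covariantHessian f y u w) (covariantHessian f y v t) := by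
  have huv := inner_fderiv_christoffel_add hf hinv u v w t
  have hvu := inner_fderiv_christoffel_add hf hinv v u w t
  have hsymm : IsSymmSndFDerivAt ℝ (fderiv ℝ f) y :=
    (hf.fderiv_right (m := 2) two_add_one_eq_three.le).isSymmSndFDerivAt (by simp)
  rw [hsymm.eq v u] at hvu
  simp only [curvature, map_add, map_sub, inner_add_left, inner_sub_left] at huv hvu ⊢
  linarith

end Gauss

end MetricInCoordinates

namespace RiemannianGeometry

open Bundle Topology Module MetricInCoordinates

variable {n : ℕ} {M : Type*} [TopologicalSpace M] [ChartedSpace (EuclideanSpace ℝ (Fin n)) M]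
  {F : Type*} [NormedAddCommGroup F]

instance finiteDimensional_tangentSpace (x : M) : FiniteDimensional ℝ (TangentSpace (𝓡 n) x) :=
  inferInstanceAs (FiniteDimensional ℝ (EuclideanSpace ℝ (Fin n)))

theorem finrank_tangentSpace (x : M) : finrank ℝ (TangentSpace (𝓡 n) x) = n :=
  finrank_euclideanSpace_fin

/-- The map `g` read in the preferred chart `φ` of `M` at `x`, that is, `g ∘ φ⁻¹`. -/
def inChart (n : ℕ) {M : Type*} [TopologicalSpace M] [ChartedSpace (EuclideanSpace ℝ (Fin n)) M]
    {F : Type*} (g : M → F) (x : M) : EuclideanSpace ℝ (Fin n) → F :=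
  g ∘ (extChartAt (𝓡 n) x).symm

section Chart

variable [NormedSpace ℝ F] {g : M → F} {x : M} {y : EuclideanSpace ℝ (Fin n)}

theorem contDiffAt_inChart {k : ℕ∞ω} [IsManifold (𝓡 n) k M]
    (hy : y ∈ (extChartAt (𝓡 n) x).target)
    (hg : ContMDiffAt (𝓡 n) 𝓘(ℝ, F) k g ((extChartAt (𝓡 n) x).symm y)) :
    ContDiffAt ℝ k (inChart n g x) y :=
  (hg.comp y ((contMDiffOn_extChartAt_symm x).contMDiffAt
    ((isOpen_extChartAt_target x).mem_nhds hy))).contDiffAt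

theorem contDiffAt_inChart_extChartAt {k : ℕ∞ω} [IsManifold (𝓡 n) k M]
    (hg : ContMDiffAt (𝓡 n) 𝓘(ℝ, F) k g x) :
    ContDiffAt ℝ k (inChart n g x) (extChartAt (𝓡 n) x x) :=
  contDiffAt_inChart (mem_extChartAt_target x) (by rwa [extChartAt_to_inv])

variable [IsManifold (𝓡 n) 1 M]

theorem chartDeriv_bijective (x : M) : Function.Bijective (chartDeriv n x) := by
  obtain ⟨e, he⟩ := isInvertible_mfderiv_extChartAt (I := 𝓡 n) (mem_extChartAt_source x)
  rw [chartDeriv, ← he]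
  exact e.bijective

theorem fderiv_inChart_apply (hy : y ∈ (extChartAt (𝓡 n) x).target)
    (hg : MDifferentiableAt (𝓡 n) 𝓘(ℝ, F) g ((extChartAt (𝓡 n) x).symm y))
    (u : EuclideanSpace ℝ (Fin n)) :
    fderiv ℝ (inChart n g x) y u =
      differential n g ((extChartAt (𝓡 n) x).symm y) (chartSymmDeriv n x y u) := by
  have hsymm : MDifferentiableAt 𝓘(ℝ, EuclideanSpace ℝ (Fin n)) (𝓡 n)
      (extChartAt (𝓡 n) x).symm y :=
    ((contMDiffOn_extChartAt_symm (n := 1) x).contMDiffAt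
      ((isOpen_extChartAt_target x).mem_nhds hy)).mdifferentiableAt one_ne_zero
  rw [← mfderiv_eq_fderiv, inChart, mfderiv_comp y hg hsymm]
  rfl

theorem fderiv_inChart_chartDeriv (hg : ContMDiffAt (𝓡 n) 𝓘(ℝ, F) 1 g x)
    (X : TangentSpace (𝓡 n) x) :
    fderiv ℝ (inChart n g x) (extChartAt (𝓡 n) x x) (chartDeriv n x X) = differential n g x X := by
  have hφ : MDifferentiableAt (𝓡 n) 𝓘(ℝ, EuclideanSpace ℝ (Fin n)) (extChartAt (𝓡 n) x) x :=
    mdifferentiableAt_extChartAt (ChartedSpace.mem_chart_source x)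
  have hf : MDifferentiableAt 𝓘(ℝ, EuclideanSpace ℝ (Fin n)) 𝓘(ℝ, F) (inChart n g x)
      (extChartAt (𝓡 n) x x) :=
    ((contDiffAt_inChart_extChartAt hg).differentiableAt one_ne_zero).mdifferentiableAt
  have hcomp : inChart n g x ∘ extChartAt (𝓡 n) x =ᶠ[𝓝 x] g := by
    filter_upwards [extChartAt_source_mem_nhds (I := 𝓡 n) x] with z hz
    exact congrArg g ((extChartAt (𝓡 n) x).left_inv hz)
  have hchain := mfderiv_comp x hf hφ
  rw [hcomp.mfderiv_eq, mfderiv_eq_fderiv] at hchain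
  exact (congrArg (fun T : TangentSpace (𝓡 n) x →L[ℝ] F => T X) hchain).symm

theorem fderiv_inChart_injective (hg : ContMDiffAt (𝓡 n) 𝓘(ℝ, F) 1 g x)
    (hinj : Function.Injective (differential n g x)) :
    Function.Injective (fderiv ℝ (inChart n g x) (extChartAt (𝓡 n) x x)) := by
  refine Function.Injective.of_comp_right ?_ (chartDeriv_bijective x).2
  rwa [show _ ∘ chartDeriv n x = _ from funext (fderiv_inChart_chartDeriv hg)]

end Chart

variable [InnerProductSpace ℝ F] {g : M → F} {x : M}

section SecondFundamentalForm

variable [FiniteDimensional ℝ F] [IsManifold (𝓡 n) 2 M]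

theorem secondFundamentalForm_symm (hg : ContMDiffAt (𝓡 n) 𝓘(ℝ, F) 2 g x)
    (X Y : TangentSpace (𝓡 n) x) :
    secondFundamentalForm n g x X Y = secondFundamentalForm n g x Y X := by
  have hsymm : IsSymmSndFDerivAt ℝ (inChart n g x) (extChartAt (𝓡 n) x x) :=
    (contDiffAt_inChart_extChartAt hg).isSymmSndFDerivAt (by simp)
  exact congrArg (normalSpace n g x).orthogonalProjectionOnto (hsymm.eq _ _)

theorem coe_secondFundamentalForm (hg : ContMDiffAt (𝓡 n) 𝓘(ℝ, F) 2 g x)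
    (hinj : Function.Injective (differential n g x)) (X Y : TangentSpace (𝓡 n) x) :
    (secondFundamentalForm n g x X Y : F) =
      covariantHessian (inChart n g x) (extChartAt (𝓡 n) x x)
        (chartDeriv n x X) (chartDeriv n x Y) := by
  have : IsManifold (𝓡 n) 1 M := .of_le (n := 2) one_le_two
  have hg₁ : ContMDiffAt (𝓡 n) 𝓘(ℝ, F) 1 g x := hg.of_le one_le_two
  refine Submodule.eq_starProjection_of_mem_of_inner_eq_zero ?_ fun w hw => ?_
  · rintro _ ⟨Z, rfl⟩
    rw [← fderiv_inChart_chartDeriv hg₁, real_inner_comm]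
    exact inner_covariantHessian_fderiv (contDiffAt_inChart_extChartAt hg)
      (isInvertible_inducedMetric (fderiv_inChart_injective hg₁ hinj)) _ _ _
  · obtain ⟨Z, hZ⟩ := (chartDeriv_bijective x).2
      (christoffel (inducedMetric (inChart n g x)) (extChartAt (𝓡 n) x x)
        (chartDeriv n x X) (chartDeriv n x Y))
    rw [covariantHessian, ← hZ, fderiv_inChart_chartDeriv hg₁]
    change inner ℝ (fderiv ℝ (fderiv ℝ (inChart n g x)) _ _ _ - _) w = 0
    rw [sub_sub_cancel]
    exact hw _ ⟨Z, rfl⟩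

end SecondFundamentalForm

theorem finrank_normalSpace_add [FiniteDimensional ℝ F]
    (hinj : Function.Injective (differential n g x)) :
    n + finrank ℝ (normalSpace n g x) = finrank ℝ F := by
  rw [← Submodule.finrank_add_finrank_orthogonal (LinearMap.range (differential n g x)),
    LinearMap.finrank_range_of_inj hinj, finrank_tangentSpace, normalSpace]

namespace IsIsometricImmersion

variable [IsManifold (𝓡 n) ∞ M] {h : ContMDiffRiemannianMetric (𝓡 n) ∞ (EuclideanSpace ℝ (Fin n))
  (fun x : M => TangentSpace (𝓡 n) x)}

theorem differential_injective (hg : IsIsometricImmersion h g) (x : M) :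
    Function.Injective (differential n g x) := by
  refine (injective_iff_map_eq_zero _).2 fun X hX => ?_
  by_contra hne
  have hpos := h.pos x X hne
  rw [← hg.inner_eq, hX, inner_zero_left] at hpos
  exact hpos.false

theorem inducedMetric_inChart (hg : IsIsometricImmersion h g) {y : EuclideanSpace ℝ (Fin n)}
    (hy : y ∈ (extChartAt (𝓡 n) x).target) :
    inducedMetric (inChart n g x) y = metricInChart h x y := by
  have hdiff : MDifferentiableAt (𝓡 n) 𝓘(ℝ, F) g ((extChartAt (𝓡 n) x).symm y) :=
    hg.contMDiff.contMDiffAt.mdifferentiableAt (by simp)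
  ext u v
  rw [inducedMetric_apply, metricInChart_apply, fderiv_inChart_apply hy hdiff,
    fderiv_inChart_apply hy hdiff, hg.inner_eq]

variable [FiniteDimensional ℝ F]

theorem gauss_equation (hg : IsIsometricImmersion h g) (x : M) (X Y Z T : TangentSpace (𝓡 n) x) :
    inner ℝ (fderiv ℝ (inChart n g x) (extChartAt (𝓡 n) x x) (curvatureInChart h x X Y Z))
        (differential n g x T) =
      inner ℝ (secondFundamentalForm n g x Y Z) (secondFundamentalForm n g x X T)
        - inner ℝ (secondFundamentalForm n g x X Z) (secondFundamentalForm n g x Y T) := by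
  have hgx (k : ℕ) : ContMDiffAt (𝓡 n) 𝓘(ℝ, F) k g x :=
    hg.contMDiff.contMDiffAt.of_le (by exact_mod_cast le_top)
  have hinj := hg.differential_injective x
  have hmetric :
      metricInChart h x =ᶠ[𝓝 (extChartAt (𝓡 n) x x)] inducedMetric (inChart n g x) := by
    filter_upwards [extChartAt_target_mem_nhds (I := 𝓡 n) x] with y hy
    exact (hg.inducedMetric_inChart hy).symm
  rw [curvatureInChart, curvature_congr hmetric, ← fderiv_inChart_chartDeriv (hgx 1)]
  simp only [Submodule.coe_inner, coe_secondFundamentalForm (hgx 2) hinj]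
  exact MetricInCoordinates.gauss_equation (contDiffAt_inChart_extChartAt (hgx 3))
    (isInvertible_inducedMetric (fderiv_inChart_injective (hgx 1) hinj)) _ _ _ _

theorem secondFundamentalForm_symm (hg : IsIsometricImmersion h g) (x : M)
    (X Y : TangentSpace (𝓡 n) x) :
    secondFundamentalForm n g x X Y = secondFundamentalForm n g x Y X :=
  RiemannianGeometry.secondFundamentalForm_symm
    (hg.contMDiff.contMDiffAt.of_le ENat.LEInfty.out) X Y

theorem isFlatAlong_nullity (hg : IsIsometricImmersion h g) (x : M) :
    BilinearMap.IsFlatAlong (secondFundamentalForm n g x) (nullity h x) := by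
  intro Z hZ X Y T
  have hsymm := hg.secondFundamentalForm_symm x
  have hgauss := hg.gauss_equation x Z T X Y
  rw [hZ T X, map_zero, inner_zero_left, hsymm T X, hsymm Z Y, hsymm Z X, hsymm T Y] at hgauss
  exact (sub_eq_zero.1 hgauss.symm).symm

end IsIsometricImmersion

end RiemannianGeometry

end

theorem mainTheorem7_general {n p : ℕ} {M : Type*} [TopologicalSpace M]
    [ChartedSpace (EuclideanSpace ℝ (Fin n)) M] [IsManifold (𝓡 n) ∞ M]
    {F : Type*} [NormedAddCommGroup F] [InnerProductSpace ℝ F] [FiniteDimensional ℝ F]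
    (hF : Module.finrank ℝ F = n + p)
    {h : Bundle.ContMDiffRiemannianMetric (𝓡 n) ∞ (EuclideanSpace ℝ (Fin n))
      (fun x : M => TangentSpace (𝓡 n) x)} {g : M → F}
    (hg : RiemannianGeometry.IsIsometricImmersion h g) (x : M) :
    Module.finrank ℝ (RiemannianGeometry.nullity h x) ≤
        Module.finrank ℝ (RiemannianGeometry.relativeNullity n g x)
          + Module.finrank ℝ
            (BilinearMap.valueSpan (RiemannianGeometry.restrictedForm h g x)) ∧
      (Module.finrank ℝ (RiemannianGeometry.relativeNullity n g x) + p < n →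
        Module.finrank ℝ
          (BilinearMap.valueSpan (RiemannianGeometry.restrictedForm h g x)) < p) := by
  have hflat := hg.isFlatAlong_nullity x
  have hnormal : Module.finrank ℝ (RiemannianGeometry.normalSpace n g x) = p :=
    Nat.add_left_cancel
      ((RiemannianGeometry.finrank_normalSpace_add (hg.differential_injective x)).trans hF)
  refine ⟨hflat.finrank_le_leftNullity_add_valueSpan (hg.secondFundamentalForm_symm x),
    fun hν => ?_⟩
  rw [← hnormal]
  refine hflat.finrank_valueSpan_lt ?_
  rwa [hnormal, RiemannianGeometry.finrank_tangentSpace]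

theorem mainTheorem7 (n p : ℕ) {M : Type*} [TopologicalSpace M]
    [ChartedSpace (EuclideanSpace ℝ (Fin n)) M] [IsManifold (𝓡 n) ∞ M]
    (h : Bundle.ContMDiffRiemannianMetric (𝓡 n) ∞ (EuclideanSpace ℝ (Fin n))
      (fun x : M => TangentSpace (𝓡 n) x))
    (g : M → EuclideanSpace ℝ (Fin (n + p)))
    (hg : RiemannianGeometry.IsIsometricImmersion h g)
    (x : M)
    (hν : (Module.finrank ℝ (RiemannianGeometry.relativeNullity n g x) : ℤ) ≤ n - p - 1) :
    (Module.finrank ℝ (RiemannianGeometry.nullity h x) : ℤ)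
        - Module.finrank ℝ (RiemannianGeometry.relativeNullity n g x)
      ≤ Module.finrank ℝ
          (BilinearMap.valueSpan (RiemannianGeometry.restrictedForm h g x)) ∧
    (Module.finrank ℝ
        (BilinearMap.valueSpan (RiemannianGeometry.restrictedForm h g x)) : ℤ) ≤ p - 1 := by
  obtain ⟨hμ, hS⟩ := mainTheorem7_general finrank_euclideanSpace_fin hg x
  exact ⟨by omega, by omega⟩
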